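/- Let $\alpha\in(0,\infty)\setminus\mathbb{N}$, let $n=[\alpha]+1$, where $[\alpha]$ is the integer part of $\alpha$, and let $T>0$. For a function $x:(0,\infty)\to\mathbb{R}$ and $t>0$ put $$^{RL}D^{\alpha}x(t)=\frac{1}{\Gamma(n-\alpha)}\Big(\frac{d}{dt}\Big)^{n}\int_0^t(t-s)^{n-\alpha-1}x(s)\,ds,\qquad {}^{C}D^{\alpha}x(t)=\frac{1}{\Gamma(n-\alpha)}\int_0^t(t-s)^{n-\alpha-1}x^{(n)}(s)\,ds,$$ $$^{GL}D^{\alpha}x(t)=\lim_{h\to0^+}h^{-\alpha}\sum_{r=0}^{[t/h]}(-1)^r\binom{\alpha}{r}x(t-rh)$$ (the Riemann–Liouville, Caputo and Grünwald–Letnikov derivatives of order $\alpha$ of $x$), where $x(0)$, which enters the last sum when $t/h$ is an integer, is given an arbitrary real value. A function $f$ on $(0,\infty)$ is called $T$-periodic if $f(t+T)=f(t)$ for all $t>0$. Let $x:(0,\infty)\to\mathbb{R}$ be a non-constant $T$-periodic function of class $C^n$ on $(0,\infty)$. Then: 1. The integral $\int_0^t(t-s)^{n-\alpha-1}x(s)\,ds$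 is of class $C^n$ on $(0,\infty)$, so that $^{RL}D^{\alpha}x$ exists on $(0,\infty)$, and $^{RL}D^{\alpha}x$ is not $T$-periodic. 2. The limit $^{GL}D^{\alpha}x(t)$ exists and equals $^{RL}D^{\alpha}x(t)$ for every $t>0$, and $^{GL}D^{\alpha}x$ is not $T$-periodic. 3. The limits $x^{(k)}(0^+)=\lim_{t\to0^+}x^{(k)}(t)$, $0\le k\le n-1$, exist. If at least one of them is non-zero, then $\lim_{t\to0^+}{}^{RL}D^{\alpha}x(t)$ is $+\infty$ or $-\infty$. If all of them are zero, then $^{RL}D^{\alpha}x(t)={}^{C}D^{\alpha}x(t)$ for every $t>0$, and $^{C}D^{\alpha}x$ is not $T$-periodic. -/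

import Mathlib

open Filter Topology Set

noncomputable section

namespace FracDeriv

/-- The integer `n = [α] + 1` attached to an order `α > 0`. -/
def ord (α : ℝ) : ℕ := ⌊α⌋₊ + 1

/-- The integral `∫ₐᵗ (t - s)^(n - α - 1) g(s) ds`, with `n = [α] + 1`. -/
def kernelIntegral (a α : ℝ) (g : ℝ → ℝ) (t : ℝ) : ℝ :=
  ∫ s in a..t, (t - s) ^ ((ord α : ℝ) - α - 1) * g s

/-- The Riemann–Liouville derivative of order `α` of `g`, based at `a`. -/
def rlDeriv (a α : ℝ) (g : ℝ → ℝ) (t : ℝ) : ℝ :=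
  1 / Real.Gamma ((ord α : ℝ) - α) * iteratedDeriv (ord α) (kernelIntegral a α g) t

/-- The Caputo derivative of order `α` of `g`, based at `a`. -/
def caputoDeriv (a α : ℝ) (g : ℝ → ℝ) (t : ℝ) : ℝ :=
  1 / Real.Gamma ((ord α : ℝ) - α) * kernelIntegral a α (iteratedDeriv (ord α) g) t

/-- The Grünwald–Letnikov difference quotient of step `h > 0`; `Ring.choose α r` is the
generalized binomial coefficient `α (α - 1) ⋯ (α - r + 1) / r!`. -/
def glQuotient (a α : ℝ) (g : ℝ → ℝ) (t h : ℝ) : ℝ :=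
  h ^ (-α) * ∑ r ∈ Finset.range (⌊(t - a) / h⌋₊ + 1),
    (-1 : ℝ) ^ r * Ring.choose α r * g (t - r * h)

/-- `L` is the Grünwald–Letnikov derivative of order `α` of `g` at `t`, based at `a`. -/
def HasGLDerivAt (a α : ℝ) (g : ℝ → ℝ) (L t : ℝ) : Prop :=
  Tendsto (glQuotient a α g t) (𝓝[>] 0) (𝓝 L)

/-- The Grünwald–Letnikov derivative as a function (meaningful where the limit exists). -/
def glDeriv (a α : ℝ) (g : ℝ → ℝ) (t : ℝ) : ℝ :=
  limUnder (𝓝[>] 0) (glQuotient a α g t)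

/-- `f`, regarded as a function on `(0, ∞)`, is `T`-periodic. -/
def PeriodicOnPos (T : ℝ) (f : ℝ → ℝ) : Prop :=
  ∀ t, 0 < t → f (t + T) = f t

end FracDeriv

end

/-!
A periodic function of class `C^n` on `(a, ∞)` extends to a periodic `C^n` function `g` on `ℝ`, and
differentiating the Riemann–Liouville integral of order `β = n - α` of `g` gives
`rlDeriv g t = ∑_{k < n} g^(k)(a) (t - a)^(k - α) / Γ(k + 1 - α) + caputoDeriv g t`.
All exponents `k - α` are negative, and the Caputo term tends to `0` at `a⁺`, so the first non-zero
initial value makes the derivative blow up at `a⁺`. A periodic derivative is bounded near `a`; hence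
all initial values vanish and `rlDeriv g` is the integral of order `β` of `z = g^(n)`. The
periodicity of `z` turns that of the integral into
`∫ u in 0..T, z (a - u) * (t + u)^(β - 1) = 0` for all `t > 0`. Repeated differentiation in `t`,
evaluated at `t = 1`, shows that `z (a - u) * (1 + u)^(β - 1)` is orthogonal to all powers of
`(1 + u)⁻¹`, hence zero by the Stone–Weierstrass theorem; thus `g^(n) = 0`, and `g = 0`.

For the Grünwald–Letnikov derivative, `n` summations by parts turn the quotient into the same sum
plus a Riemann sum of the Caputo integral, by the identity
`(-1)^r * choose α r = multichoose (-α) r` and the asymptotics `multichoose s r ~ r^(s - 1) / Γ(s)`.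
-/

namespace FracDeriv

open MeasureTheory
open scoped fwdDiff

section ParametricIntegral

theorem exists_eventually_forall_norm_le {X Y E : Type*} [TopologicalSpace X] [TopologicalSpace Y]
    [SeminormedAddCommGroup E] {F : X → Y → E} {U : Set X} {K : Set Y} (hU : IsOpen U)
    (hK : IsCompact K) (hF : ContinuousOn (Function.uncurry F) (U ×ˢ K)) {t : X} (ht : t ∈ U) :
    ∃ B, ∀ᶠ τ in 𝓝 t, ∀ v ∈ K, ‖F τ v‖ ≤ B := by
  have hFt : ContinuousOn (F t) K :=
    hF.comp (Continuous.prodMk_right t).continuousOn fun v hv => ⟨ht, hv⟩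
  obtain ⟨B, hB⟩ := hK.exists_bound_of_continuousOn hFt
  refine ⟨B + 1, hK.eventually_forall_of_forall_eventually
    (P := fun τ v => v ∈ K → ‖F τ v‖ ≤ B + 1) (fun v hv => ?_) |>.mono fun τ hτ v hv => hτ v hv hv⟩
  have hlt : ∀ᶠ z in 𝓝[U ×ˢ K] (t, v), ‖Function.uncurry F z‖ < B + 1 :=
    (hF (t, v) ⟨ht, hv⟩).norm.eventually_lt_const (lt_add_of_le_of_pos (hB v hv) one_pos)
  have hU' : ∀ᶠ z : X × Y in 𝓝 (t, v), z.1 ∈ U := continuousAt_fst.eventually_mem (hU.mem_nhds ht)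
  filter_upwards [eventually_nhdsWithin_iff.1 hlt, hU'] with z hz hzU hzK
  exact (hz ⟨hzU, hzK⟩).le

variable {E : Type*} [NormedAddCommGroup E] [NormedSpace ℝ E] {k : ℝ → ℝ} {F : ℝ → ℝ → E}
  {U : Set ℝ} {a b : ℝ}

theorem intervalIntegrable_smul_of_mem (hk : IntervalIntegrable k volume a b)
    (hF : ContinuousOn (Function.uncurry F) (U ×ˢ uIcc a b)) {t : ℝ} (ht : t ∈ U) :
    IntervalIntegrable (fun v => k v • F t v) volume a b :=
  hk.smul_continuousOn <|
    hF.comp (Continuous.prodMk_right t).continuousOn fun _ hv => ⟨ht, hv⟩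

theorem exists_eventually_forall_norm_smul_le (hU : IsOpen U)
    (hF : ContinuousOn (Function.uncurry F) (U ×ˢ uIcc a b)) {t : ℝ} (ht : t ∈ U) :
    ∃ B, ∀ᶠ τ in 𝓝 t, ∀ v ∈ uIoc a b, ‖k v • F τ v‖ ≤ |k v| * B := by
  obtain ⟨B, hB⟩ := exists_eventually_forall_norm_le hU isCompact_uIcc hF ht
  refine ⟨B, hB.mono fun τ hτ v hv => ?_⟩
  rw [norm_smul, Real.norm_eq_abs]
  exact mul_le_mul_of_nonneg_left (hτ v (uIoc_subset_uIcc hv)) (abs_nonneg _)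

theorem continuousOn_integral_smul (hU : IsOpen U) (hk : IntervalIntegrable k volume a b)
    (hF : ContinuousOn (Function.uncurry F) (U ×ˢ uIcc a b)) :
    ContinuousOn (fun t => ∫ v in a..b, k v • F t v) U := by
  intro t ht
  refine ContinuousAt.continuousWithinAt ?_
  obtain ⟨B, hB⟩ := exists_eventually_forall_norm_smul_le (k := k) hU hF ht
  refine intervalIntegral.continuousAt_of_dominated_interval (bound := fun v => |k v| * B) ?_
    (hB.mono fun τ hτ => Eventually.of_forall hτ) (hk.abs.mul_const B)
    (Eventually.of_forall fun v hv => ?_)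
  · filter_upwards [hU.mem_nhds ht] with τ hτ
    exact (intervalIntegrable_smul_of_mem hk hF hτ).def'.aestronglyMeasurable
  · have hFv : ContinuousOn (fun τ => F τ v) U :=
      hF.comp (Continuous.prodMk_left v).continuousOn fun _ hτ => ⟨hτ, uIoc_subset_uIcc hv⟩
    exact continuousAt_const.smul (hFv.continuousAt (hU.mem_nhds ht))

theorem hasDerivAt_integral_smul (hU : IsOpen U) (hk : IntervalIntegrable k volume a b)
    {F' : ℝ → ℝ → E} (hF : ContinuousOn (Function.uncurry F) (U ×ˢ uIcc a b))
    (hF' : ContinuousOn (Function.uncurry F') (U ×ˢ uIcc a b))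
    (hderiv : ∀ t ∈ U, ∀ v ∈ uIcc a b, HasDerivAt (fun τ => F τ v) (F' t v) t) {t : ℝ}
    (ht : t ∈ U) :
    HasDerivAt (fun τ => ∫ v in a..b, k v • F τ v) (∫ v in a..b, k v • F' t v) t := by
  obtain ⟨B, hB⟩ := exists_eventually_forall_norm_smul_le (k := k) hU hF' ht
  refine (intervalIntegral.hasDerivAt_integral_of_dominated_loc_of_deriv_le
    (bound := fun v => |k v| * B) (hB.and (hU.mem_nhds ht)) ?_
    (intervalIntegrable_smul_of_mem hk hF ht)
    (intervalIntegrable_smul_of_mem hk hF' ht).def'.aestronglyMeasurable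
    (Eventually.of_forall fun v hv τ hτ => hτ.1 v hv) (hk.abs.mul_const B)
    (Eventually.of_forall fun v hv τ hτ =>
      (hderiv τ hτ.2 v (uIoc_subset_uIcc hv)).const_smul (k v))).2
  filter_upwards [hU.mem_nhds ht] with τ hτ
  exact (intervalIntegrable_smul_of_mem hk hF hτ).def'.aestronglyMeasurable

end ParametricIntegral

section PowerKernel

variable {β t : ℝ}

/-- The kernel `t ^ (β - 1) / Γ(β)` of the Riemann–Liouville integral of order `β`. At the poles
of `Γ` the convention `Γ(-m) = 0` makes it vanish, in agreement with `1 / Γ(-m) = 0`, so the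
rules of calculus hold for every order. -/
noncomputable def powerKernel (β t : ℝ) : ℝ := t ^ (β - 1) / Real.Gamma β

theorem sub_one_div_Gamma (β : ℝ) : (β - 1) / Real.Gamma β = 1 / Real.Gamma (β - 1) := by
  rcases eq_or_ne β 1 with rfl | hβ
  · simp [Real.Gamma_zero]
  · have hβ' : β - 1 ≠ 0 := sub_ne_zero.2 hβ
    have hΓ := Real.Gamma_add_one hβ'
    rw [sub_add_cancel] at hΓ
    rw [hΓ, div_mul_cancel_left₀ hβ', one_div]

theorem hasDerivAt_powerKernel (β : ℝ) (ht : t ≠ 0) :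
    HasDerivAt (powerKernel β) (powerKernel (β - 1) t) t := by
  refine ((Real.hasDerivAt_rpow_const (Or.inl ht)).div_const (Real.Gamma β)).congr_deriv ?_
  rw [mul_div_right_comm, sub_one_div_Gamma, powerKernel, div_mul_eq_mul_div, one_mul]

theorem contDiffAt_powerKernel (β : ℝ) (ht : t ≠ 0) {n : WithTop ℕ∞} :
    ContDiffAt ℝ n (powerKernel β) t :=
  (Real.contDiffAt_rpow_const_of_ne ht).div_const _

theorem iteratedDeriv_powerKernel (β : ℝ) (k : ℕ) (ht : t ≠ 0) :
    iteratedDeriv k (powerKernel β) t = powerKernel (β - k) t := by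
  induction k generalizing t with
  | zero => simp
  | succ k ih =>
    have heq : iteratedDeriv k (powerKernel β) =ᶠ[𝓝 t] powerKernel (β - k) := by
      filter_upwards [isOpen_ne.mem_nhds ht] with s hs using ih hs
    rw [iteratedDeriv_succ, heq.deriv_eq, (hasDerivAt_powerKernel _ ht).deriv, Nat.cast_succ,
      sub_add_eq_sub_sub]

theorem powerKernel_mul (β : ℝ) {c v : ℝ} (hc : 0 ≤ c) (hv : 0 ≤ v) :
    powerKernel β (c * v) = c ^ (β - 1) * powerKernel β v := by
  rw [powerKernel, Real.mul_rpow hc hv, mul_div_assoc, powerKernel]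

theorem intervalIntegrable_powerKernel (hβ : 0 < β) (a b : ℝ) :
    IntervalIntegrable (powerKernel β) volume a b :=
  (intervalIntegral.intervalIntegrable_rpow' (by linarith)).div_const _

theorem mul_integral_powerKernel_mul (hβ : 0 < β) {g : ℝ → ℝ} (hg : ContDiff ℝ 1 g) :
    β * ∫ v in (0 : ℝ)..1, powerKernel β v * g v =
      g 1 / Real.Gamma β - ∫ v in (0 : ℝ)..1, powerKernel β v * (v * deriv g v) := by
  have hprim : ∀ v ∈ Ioo (min (0 : ℝ) 1) (max 0 1),
      HasDerivAt (fun v => v ^ β / Real.Gamma β) (β * powerKernel β v) v := fun v hv => by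
    rw [min_eq_left zero_le_one] at hv
    refine ((Real.hasDerivAt_rpow_const (Or.inl hv.1.ne')).div_const _).congr_deriv ?_
    rw [powerKernel, mul_div_assoc]
  have hparts := intervalIntegral.integral_mul_deriv_eq_deriv_mul_of_hasDerivAt
    (u := fun v => v ^ β / Real.Gamma β) (v := g) (v' := deriv g)
    ((Real.continuous_rpow_const hβ.le).div_const _).continuousOn hg.continuous.continuousOn
    hprim (fun v _ => (hg.differentiable one_ne_zero v).hasDerivAt)
    ((intervalIntegrable_powerKernel hβ 0 1).const_mul β)
    ((hg.continuous_deriv le_rfl).intervalIntegrable 0 1)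
  have hscale : ∫ v in (0 : ℝ)..1, powerKernel β v * (v * deriv g v) =
      ∫ v in (0 : ℝ)..1, v ^ β / Real.Gamma β * deriv g v := by
    refine intervalIntegral.integral_congr_ae (Eventually.of_forall fun v hv => ?_)
    rw [uIoc_of_le zero_le_one] at hv
    rw [powerKernel, Real.rpow_sub_one hv.1.ne']
    field_simp [hv.1.ne']
  rw [hscale, hparts]
  simp only [mul_assoc, intervalIntegral.integral_const_mul, Real.one_rpow,
    Real.zero_rpow hβ.ne']
  ring

end PowerKernel

section RLIntegral

variable {a β t : ℝ} {g : ℝ → ℝ}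

/-- The Riemann–Liouville integral of order `β > 0` of `g`, based at `a`. -/
noncomputable def rlIntegral (a β : ℝ) (g : ℝ → ℝ) (t : ℝ) : ℝ :=
  ∫ s in a..t, powerKernel β (t - s) * g s

theorem rlIntegral_eq_integral_comp_sub (a β : ℝ) (g : ℝ → ℝ) (t : ℝ) :
    rlIntegral a β g t = ∫ u in (0 : ℝ)..t - a, powerKernel β u * g (t - u) := by
  have h := intervalIntegral.integral_comp_sub_left (a := a) (b := t)
    (fun u => powerKernel β u * g (t - u)) t
  simp only [sub_sub_cancel, sub_self] at h
  exact h

theorem rlIntegral_eq_rpow_mul_integral (β : ℝ) (g : ℝ → ℝ) (ht : a < t) :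
    rlIntegral a β g t =
      (t - a) ^ β * ∫ v in (0 : ℝ)..1, powerKernel β v * g (t - (t - a) * v) := by
  have hta : 0 < t - a := sub_pos.2 ht
  have h := intervalIntegral.smul_integral_comp_mul_left (a := 0) (b := 1)
    (fun u => powerKernel β u * g (t - u)) (t - a)
  rw [mul_zero, mul_one, smul_eq_mul, ← rlIntegral_eq_integral_comp_sub] at h
  rw [← h, ← intervalIntegral.integral_const_mul, ← intervalIntegral.integral_const_mul]
  refine intervalIntegral.integral_congr fun v hv => ?_
  rw [uIcc_of_le zero_le_one] at hv
  simp only [powerKernel_mul β hta.le hv.1, Real.rpow_sub_one hta.ne']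
  field_simp

theorem continuous_integral_powerKernel_mul_comp (hβ : 0 < β) (hg : Continuous g) (a : ℝ) :
    Continuous fun t => ∫ v in (0 : ℝ)..1, powerKernel β v * g (t - (t - a) * v) :=
  continuousOn_univ.1 <| continuousOn_integral_smul isOpen_univ
    (intervalIntegrable_powerKernel hβ 0 1) (F := fun t v => g (t - (t - a) * v))
    (Continuous.continuousOn (by fun_prop))

theorem continuousOn_rlIntegral (hβ : 0 < β) (hg : Continuous g) (a : ℝ) :
    ContinuousOn (rlIntegral a β g) (Ioi a) :=
  (((Real.continuous_rpow_const hβ.le).comp (continuous_sub_right a)).mul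
    (continuous_integral_powerKernel_mul_comp hβ hg a)).continuousOn.congr
    fun _ ht => rlIntegral_eq_rpow_mul_integral β g ht

theorem tendsto_rlIntegral_nhdsGT (hβ : 0 < β) (hg : Continuous g) (a : ℝ) :
    Tendsto (rlIntegral a β g) (𝓝[>] a) (𝓝 0) := by
  have hcont := ((Real.continuous_rpow_const hβ.le).comp (continuous_sub_right a)).mul
    (continuous_integral_powerKernel_mul_comp hβ hg a)
  have hlim := (hcont.tendsto a).mono_left (nhdsWithin_le_nhds (s := Ioi a))
  simp only [Pi.mul_apply, Function.comp_apply, sub_self, Real.zero_rpow hβ.ne', zero_mul] at hlim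
  exact hlim.congr' <| eventually_mem_nhdsWithin.mono fun t ht =>
    (rlIntegral_eq_rpow_mul_integral β g ht).symm

theorem hasDerivAt_integral_powerKernel_mul_comp (hβ : 0 < β) (hg : ContDiff ℝ 1 g) (a t : ℝ) :
    HasDerivAt (fun t => ∫ v in (0 : ℝ)..1, powerKernel β v * g (t - (t - a) * v))
      (∫ v in (0 : ℝ)..1, powerKernel β v * ((1 - v) * deriv g (t - (t - a) * v))) t := by
  have : Continuous (deriv g) := hg.continuous_deriv le_rfl
  refine hasDerivAt_integral_smul isOpen_univ (intervalIntegrable_powerKernel hβ 0 1)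
    (F := fun t v => g (t - (t - a) * v))
    (F' := fun t v => (1 - v) * deriv g (t - (t - a) * v)) ?_ ?_ (fun t _ v _ => ?_) (mem_univ t)
  · have := hg.continuous
    exact Continuous.continuousOn (by fun_prop)
  · exact Continuous.continuousOn (by fun_prop)
  · have hlin : HasDerivAt (fun t : ℝ => t - (t - a) * v) (1 - 1 * v) t :=
      (hasDerivAt_id t).sub (((hasDerivAt_id t).sub_const a).mul_const v)
    have hcomp := (hg.differentiable one_ne_zero (t - (t - a) * v)).hasDerivAt.comp t hlin
    rwa [one_mul, mul_comm] at hcomp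

theorem mul_integral_powerKernel_mul_comp (hβ : 0 < β) (hg : ContDiff ℝ 1 g) (a t : ℝ) :
    β * ∫ v in (0 : ℝ)..1, powerKernel β v * g (t - (t - a) * v) =
      g a / Real.Gamma β +
        (t - a) * ∫ v in (0 : ℝ)..1, powerKernel β v * (v * deriv g (t - (t - a) * v)) := by
  have hderiv : ∀ v, deriv (fun v => g (t - (t - a) * v)) v =
      -((t - a) * deriv g (t - (t - a) * v)) := fun v => by
    have hlin : HasDerivAt (fun v : ℝ => t - (t - a) * v) (-((t - a) * 1)) v :=
      ((hasDerivAt_id v).const_mul (t - a)).const_sub t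
    have hcomp := (hg.differentiable one_ne_zero (t - (t - a) * v)).hasDerivAt.comp v hlin
    rw [mul_one, mul_neg, mul_comm] at hcomp
    exact hcomp.deriv
  rw [mul_integral_powerKernel_mul (g := fun v => g (t - (t - a) * v)) hβ
      (hg.comp (by fun_prop)), mul_one, sub_sub_cancel, ← intervalIntegral.integral_const_mul,
    ← sub_neg_eq_add, ← intervalIntegral.integral_neg]
  congr 2 with v
  rw [hderiv]
  ring

theorem hasDerivAt_rlIntegral (hβ : 0 < β) (hg : ContDiff ℝ 1 g) (ht : a < t) :
    HasDerivAt (rlIntegral a β g)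
      (g a * powerKernel β (t - a) + rlIntegral a β (deriv g) t) t := by
  have hta : 0 < t - a := sub_pos.2 ht
  have : Continuous (deriv g) := hg.continuous_deriv le_rfl
  have hscaled := (((hasDerivAt_id' t).sub_const a).rpow_const (p := β) (Or.inl hta.ne')).fun_mul
    (hasDerivAt_integral_powerKernel_mul_comp hβ hg a t)
  refine (hscaled.congr_of_eventuallyEq ?_).congr_deriv ?_
  · filter_upwards [Ioi_mem_nhds ht] with τ hτ using rlIntegral_eq_rpow_mul_integral β g hτ
  have hint : ∀ {f : ℝ → ℝ}, Continuous f →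
      IntervalIntegrable (fun v => powerKernel β v * f v) volume 0 1 := fun hf =>
    (intervalIntegrable_powerKernel hβ 0 1).mul_continuousOn hf.continuousOn
  have hsplit : (∫ v in (0 : ℝ)..1, powerKernel β v * ((1 - v) * deriv g (t - (t - a) * v))) =
      (∫ v in (0 : ℝ)..1, powerKernel β v * deriv g (t - (t - a) * v)) -
        ∫ v in (0 : ℝ)..1, powerKernel β v * (v * deriv g (t - (t - a) * v)) := by
    rw [← intervalIntegral.integral_sub (hint (by fun_prop)) (hint (by fun_prop))]
    simp only [sub_mul, mul_sub, one_mul]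
  rw [one_mul, mul_right_comm, mul_integral_powerKernel_mul_comp hβ hg, hsplit,
    rlIntegral_eq_rpow_mul_integral _ _ ht, powerKernel, Real.rpow_sub_one hta.ne']
  field_simp
  ring

theorem contDiffOn_powerKernel_comp_sub (a β : ℝ) {n : WithTop ℕ∞} :
    ContDiffOn ℝ n (fun t => powerKernel β (t - a)) (Ioi a) := fun t ht =>
  ((contDiffAt_powerKernel β (sub_pos.2 ht).ne').comp t (f := fun t : ℝ => t - a)
    (by fun_prop)).contDiffWithinAt

theorem contDiffOn_rlIntegral (hβ : 0 < β) {n : ℕ} (hg : ContDiff ℝ n g) (a : ℝ) :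
    ContDiffOn ℝ n (rlIntegral a β g) (Ioi a) := by
  induction n generalizing g with
  | zero => exact contDiffOn_zero.2 (continuousOn_rlIntegral hβ hg.continuous a)
  | succ n ih =>
    have hd : ∀ t ∈ Ioi a, HasDerivAt (rlIntegral a β g) _ t := fun t ht =>
      hasDerivAt_rlIntegral hβ (hg.of_le (by exact_mod_cast n.succ_pos)) ht
    have hg' : ContDiff ℝ n (deriv g) := (contDiff_succ_iff_deriv.1 (by exact_mod_cast hg)).2.2
    rw [Nat.cast_succ, contDiffOn_succ_iff_deriv_of_isOpen isOpen_Ioi]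
    refine ⟨fun t ht => (hd t ht).differentiableAt.differentiableWithinAt, by simp, ?_⟩
    exact ((contDiffOn_const.mul (contDiffOn_powerKernel_comp_sub a β)).add (ih hg')).congr
      fun t ht => (hd t ht).deriv

theorem iteratedDeriv_rlIntegral (hβ : 0 < β) (n : ℕ) (hg : ContDiff ℝ n g) (ht : a < t) :
    iteratedDeriv n (rlIntegral a β g) t =
      (∑ k ∈ Finset.range n, iteratedDeriv k g a * powerKernel (β + k + 1 - n) (t - a)) +
        rlIntegral a β (iteratedDeriv n g) t := by
  induction n generalizing g with
  | zero => simp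
  | succ n ih =>
    have hg' : ContDiff ℝ n (deriv g) := (contDiff_succ_iff_deriv.1 (by exact_mod_cast hg)).2.2
    have hderiv : EqOn (deriv (rlIntegral a β g))
        (fun t => g a * powerKernel β (t - a) + rlIntegral a β (deriv g) t) (Ioi a) :=
      fun t ht => (hasDerivAt_rlIntegral hβ (hg.of_le (by exact_mod_cast n.succ_pos)) ht).deriv
    have hkernel : iteratedDeriv n (fun t => powerKernel β (t - a)) t =
        powerKernel (β - n) (t - a) := by
      rw [iteratedDeriv_comp_sub_const]
      exact iteratedDeriv_powerKernel β n (sub_pos.2 ht).ne'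
    rw [iteratedDeriv_succ', hderiv.iteratedDeriv_of_isOpen isOpen_Ioi n ht,
      iteratedDeriv_fun_add
        ((contDiffOn_const.mul (contDiffOn_powerKernel_comp_sub a β)).contDiffAt (Ioi_mem_nhds ht))
        ((contDiffOn_rlIntegral hβ hg' a).contDiffAt (Ioi_mem_nhds ht)),
      iteratedDeriv_const_mul_field, hkernel, ih hg', Finset.sum_range_succ', iteratedDeriv_succ']
    simp only [iteratedDeriv_succ', iteratedDeriv_zero, Nat.cast_add, Nat.cast_one,
      Nat.cast_zero]
    ring_nf

end RLIntegral

section RLDeriv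

variable {a α t : ℝ} {g : ℝ → ℝ}

theorem ord_sub_pos (α : ℝ) : 0 < (ord α : ℝ) - α := by
  simpa [ord] using Nat.lt_floor_add_one α

theorem ord_sub_lt_one (hα : 0 < α) (hαN : ∀ m : ℕ, α ≠ m) : (ord α : ℝ) - α < 1 := by
  have h := lt_of_le_of_ne (Nat.floor_le hα.le) (hαN _).symm
  rw [ord, Nat.cast_succ]
  linarith

theorem natCast_lt_of_lt_ord (hα : 0 < α) (hαN : ∀ m : ℕ, α ≠ m) {k : ℕ} (hk : k < ord α) :
    (k : ℝ) < α :=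
  lt_of_le_of_ne ((Nat.le_floor_iff hα.le).1 (Nat.le_of_lt_succ hk)) (hαN k).symm

theorem natCast_add_one_sub_ne_neg (hαN : ∀ m : ℕ, α ≠ m) (k m : ℕ) : (k : ℝ) + 1 - α ≠ -m :=
  fun h => hαN (k + 1 + m) (by push_cast; linarith)

theorem kernelIntegral_eq_Gamma_mul_rlIntegral (a α : ℝ) (g : ℝ → ℝ) (t : ℝ) :
    kernelIntegral a α g t = Real.Gamma (ord α - α) * rlIntegral a (ord α - α) g t := by
  have hΓ : Real.Gamma (ord α - α) ≠ 0 := (Real.Gamma_pos_of_pos (ord_sub_pos α)).ne'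
  rw [kernelIntegral, rlIntegral, ← intervalIntegral.integral_const_mul]
  refine intervalIntegral.integral_congr fun s _ => ?_
  simp only [powerKernel]
  field_simp

theorem contDiffOn_kernelIntegral (hg : ContDiff ℝ (ord α) g) (a : ℝ) :
    ContDiffOn ℝ (ord α) (kernelIntegral a α g) (Ioi a) :=
  (contDiffOn_const.mul (contDiffOn_rlIntegral (ord_sub_pos α) hg a)).congr
    fun t _ => kernelIntegral_eq_Gamma_mul_rlIntegral a α g t

theorem rlDeriv_eq_iteratedDeriv_rlIntegral (a α : ℝ) (g : ℝ → ℝ) (t : ℝ) :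
    rlDeriv a α g t = iteratedDeriv (ord α) (rlIntegral a (ord α - α) g) t := by
  have hΓ : Real.Gamma (ord α - α) ≠ 0 := (Real.Gamma_pos_of_pos (ord_sub_pos α)).ne'
  rw [rlDeriv, funext (kernelIntegral_eq_Gamma_mul_rlIntegral a α g),
    iteratedDeriv_const_mul_field, one_div, inv_mul_cancel_left₀ hΓ]

theorem caputoDeriv_eq_rlIntegral (a α : ℝ) (g : ℝ → ℝ) (t : ℝ) :
    caputoDeriv a α g t = rlIntegral a (ord α - α) (iteratedDeriv (ord α) g) t := by
  have hΓ : Real.Gamma (ord α - α) ≠ 0 := (Real.Gamma_pos_of_pos (ord_sub_pos α)).ne'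
  rw [caputoDeriv, kernelIntegral_eq_Gamma_mul_rlIntegral, one_div, inv_mul_cancel_left₀ hΓ]

theorem continuousOn_rlDeriv (hg : ContDiff ℝ (ord α) g) (a : ℝ) :
    ContinuousOn (rlDeriv a α g) (Ioi a) :=
  continuousOn_const.mul <|
    ((contDiffOn_kernelIntegral hg a).continuousOn_iteratedDerivWithin le_rfl
      (uniqueDiffOn_Ioi a)).congr (iteratedDerivWithin_of_isOpen isOpen_Ioi).symm

theorem rlDeriv_eq_sum_add_caputoDeriv (hg : ContDiff ℝ (ord α) g) (ht : a < t) :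
    rlDeriv a α g t =
      (∑ k ∈ Finset.range (ord α), iteratedDeriv k g a * powerKernel (k + 1 - α) (t - a)) +
        caputoDeriv a α g t := by
  rw [rlDeriv_eq_iteratedDeriv_rlIntegral, caputoDeriv_eq_rlIntegral,
    iteratedDeriv_rlIntegral (ord_sub_pos α) _ hg ht]
  congr! 4 with k
  ring

theorem rlDeriv_eq_caputoDeriv (hg : ContDiff ℝ (ord α) g)
    (h0 : ∀ k < ord α, iteratedDeriv k g a = 0) (ht : a < t) :
    rlDeriv a α g t = caputoDeriv a α g t := by
  rw [rlDeriv_eq_sum_add_caputoDeriv hg ht, Finset.sum_eq_zero, zero_add]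
  intro k hk
  rw [h0 k (Finset.mem_range.1 hk), zero_mul]

theorem tendsto_caputoDeriv_nhdsGT (hg : ContDiff ℝ (ord α) g) (a : ℝ) :
    Tendsto (caputoDeriv a α g) (𝓝[>] a) (𝓝 0) := by
  rw [funext (caputoDeriv_eq_rlIntegral a α g)]
  exact tendsto_rlIntegral_nhdsGT (ord_sub_pos α) (hg.continuous_iteratedDeriv _ le_rfl) a

theorem tendsto_atTop_or_atBot_of_tendsto_rpow_mul {f : ℝ → ℝ} {p A : ℝ} (hp : 0 < p)
    (hA : A ≠ 0) (h : Tendsto (fun t => (t - a) ^ p * f t) (𝓝[>] a) (𝓝 A)) :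
    Tendsto f (𝓝[>] a) atTop ∨ Tendsto f (𝓝[>] a) atBot := by
  have hsub : Tendsto (fun t => t - a) (𝓝[>] a) (𝓝[>] 0) := by
    refine tendsto_nhdsWithin_iff.2
      ⟨?_, eventually_mem_nhdsWithin.mono fun t ht => mem_Ioi.2 (sub_pos.2 ht)⟩
    simpa using ((continuous_sub_right a).tendsto a).mono_left nhdsWithin_le_nhds
  have hinf : Tendsto (fun t => (t - a) ^ (-p)) (𝓝[>] a) atTop :=
    (tendsto_rpow_neg_nhdsGT_zero (neg_neg_of_pos hp)).comp hsub
  have heq : (fun t => (t - a) ^ (-p) * ((t - a) ^ p * f t)) =ᶠ[𝓝[>] a] f := by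
    filter_upwards [self_mem_nhdsWithin] with t ht
    rw [← mul_assoc, ← Real.rpow_add (sub_pos.2 ht), neg_add_cancel, Real.rpow_zero, one_mul]
  rcases hA.lt_or_gt with hA | hA
  · exact Or.inr ((hinf.atTop_mul_neg hA h).congr' heq)
  · exact Or.inl ((hinf.atTop_mul_pos hA h).congr' heq)

theorem tendsto_sub_rpow_nhdsGT (a : ℝ) {p : ℝ} (hp : 0 < p) :
    Tendsto (fun t => (t - a) ^ p) (𝓝[>] a) (𝓝 0) := by
  have h := ((Real.continuous_rpow_const hp.le).comp (continuous_sub_right a)).tendsto a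
  simp only [Function.comp_apply, sub_self, Real.zero_rpow hp.ne'] at h
  exact h.mono_left nhdsWithin_le_nhds

theorem tendsto_rpow_mul_sum_powerKernel (a α : ℝ) {c : ℕ → ℝ} {n k₀ : ℕ} (hk₀ : k₀ < n)
    (hc : ∀ k < k₀, c k = 0) :
    Tendsto (fun t => (t - a) ^ (α - k₀) *
        ∑ k ∈ Finset.range n, c k * powerKernel (k + 1 - α) (t - a)) (𝓝[>] a)
      (𝓝 (c k₀ / Real.Gamma (k₀ + 1 - α))) := by
  have hterm : ∀ k, Tendsto (fun t => c k * ((t - a) ^ ((k : ℝ) - k₀) / Real.Gamma (k + 1 - α)))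
      (𝓝[>] a) (𝓝 (if k = k₀ then c k₀ / Real.Gamma (k₀ + 1 - α) else 0)) := fun k => by
    rcases lt_trichotomy k k₀ with hk | rfl | hk
    · simp [hc k hk, hk.ne]
    · simp [div_eq_mul_inv]
    · have hp : (0 : ℝ) < (k : ℝ) - k₀ := sub_pos.2 (by exact_mod_cast hk)
      simpa [hk.ne'] using ((tendsto_sub_rpow_nhdsGT a hp).div_const _).const_mul (c k)
  have hsum := tendsto_finsetSum (Finset.range n) fun k _ => hterm k
  rw [Finset.sum_ite_eq', if_pos (Finset.mem_range.2 hk₀)] at hsum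
  refine hsum.congr' ?_
  filter_upwards [self_mem_nhdsWithin] with t ht
  rw [Finset.mul_sum]
  refine Finset.sum_congr rfl fun k _ => ?_
  rw [powerKernel, show (k : ℝ) - k₀ = (α - k₀) + (k + 1 - α - 1) by ring,
    Real.rpow_add (sub_pos.2 ht)]
  ring

theorem tendsto_rlDeriv_atTop_or_atBot (hα : 0 < α) (hαN : ∀ m : ℕ, α ≠ m)
    (hg : ContDiff ℝ (ord α) g) (hne : ∃ k < ord α, iteratedDeriv k g a ≠ 0) :
    Tendsto (rlDeriv a α g) (𝓝[>] a) atTop ∨ Tendsto (rlDeriv a α g) (𝓝[>] a) atBot := by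
  classical
  obtain ⟨k₀, ⟨hk₀, hne₀⟩, hmin⟩ := Nat.findX hne
  have hzero : ∀ k < k₀, iteratedDeriv k g a = 0 := fun k hk =>
    not_not.1 fun h => hmin k hk ⟨hk.trans hk₀, h⟩
  have hp : 0 < α - k₀ := sub_pos.2 (natCast_lt_of_lt_ord hα hαN hk₀)
  have hlim := (tendsto_rpow_mul_sum_powerKernel a α hk₀ hzero).add
    ((tendsto_sub_rpow_nhdsGT a hp).mul (tendsto_caputoDeriv_nhdsGT hg a))
  rw [mul_zero, add_zero] at hlim
  refine tendsto_atTop_or_atBot_of_tendsto_rpow_mul hp (div_ne_zero hne₀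
    (Real.Gamma_ne_zero (natCast_add_one_sub_ne_neg hαN k₀))) (hlim.congr' ?_)
  filter_upwards [self_mem_nhdsWithin] with t ht
  rw [rlDeriv_eq_sum_add_caputoDeriv hg ht, mul_add]

end RLDeriv

section Multichoose

variable {s u : ℝ}

theorem neg_one_pow_mul_choose (α : ℝ) (r : ℕ) :
    (-1 : ℝ) ^ r * Ring.choose α r = Ring.multichoose (-α) r := by
  have h := Ring.choose_neg (-α) r
  rw [neg_neg] at h
  rw [h, Ring.multichoose_eq, Units.smul_def, zsmul_eq_mul, ← mul_assoc]
  simp [← mul_pow]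

theorem ascPochhammer_eval_eq_prod {R : Type*} [CommSemiring R] (s : R) (m : ℕ) :
    (ascPochhammer R m).eval s = ∏ j ∈ Finset.range m, (s + j) := by
  induction m with
  | zero => simp
  | succ m ih => rw [ascPochhammer_succ_eval, ih, Finset.prod_range_succ]

theorem multichoose_eq_prod_div (s : ℝ) (m : ℕ) :
    Ring.multichoose s m = (∏ j ∈ Finset.range m, (s + j)) / m.factorial := by
  have h := Ring.factorial_nsmul_multichoose_eq_ascPochhammer s m
  rw [Polynomial.ascPochhammer_smeval_eq_eval, ascPochhammer_eval_eq_prod, nsmul_eq_mul] at h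
  rw [← h, mul_div_cancel_left₀ _ (by positivity)]

theorem tendsto_multichoose_mul_rpow (hs : ∀ m : ℕ, s ≠ -m) :
    Tendsto (fun m : ℕ => Ring.multichoose s m * (m : ℝ) ^ (1 - s)) atTop
      (𝓝 (Real.Gamma s)⁻¹) := by
  have hlim := (tendsto_natCast_div_add_atTop s).div (Real.GammaSeq_tendsto_Gamma s)
    (Real.Gamma_ne_zero hs)
  rw [one_div] at hlim
  refine hlim.congr' ?_
  filter_upwards [eventually_gt_atTop 0] with m hm
  have hm' : (0 : ℝ) < m := by exact_mod_cast hm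
  have hne : ∀ j : ℕ, s + j ≠ 0 := fun j h => hs j (eq_neg_of_add_eq_zero_left h)
  have hprod : ∏ j ∈ Finset.range m, (s + j) ≠ 0 := Finset.prod_ne_zero_iff.2 fun j _ => hne j
  have hm_add : (m : ℝ) + s ≠ 0 := add_comm s m ▸ hne m
  have hpow : (m : ℝ) ^ s ≠ 0 := (Real.rpow_pos_of_pos hm' s).ne'
  rw [Pi.div_apply, multichoose_eq_prod_div, Real.GammaSeq, Finset.prod_range_succ, add_comm s m,
    Real.rpow_sub hm', Real.rpow_one]
  field_simp

theorem exists_forall_abs_multichoose_le (hs : ∀ m : ℕ, s ≠ -m) :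
    ∃ C, ∀ m : ℕ, |Ring.multichoose s m| ≤ C * ((m : ℝ) + 1) ^ (s - 1) := by
  have hratio := (Real.continuousAt_rpow_const 1 (s - 1) (Or.inl one_ne_zero)).tendsto.comp
    (tendsto_natCast_div_add_atTop (1 : ℝ))
  have hlim : Tendsto (fun m : ℕ => Ring.multichoose s m * ((m : ℝ) + 1) ^ (1 - s)) atTop
      (𝓝 ((Real.Gamma s)⁻¹ * 1 ^ (s - 1))) := by
    refine ((tendsto_multichoose_mul_rpow hs).mul hratio).congr' ?_
    filter_upwards [eventually_gt_atTop 0] with m hm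
    have hm' : (0 : ℝ) < m := by exact_mod_cast hm
    rw [Function.comp_apply, Real.div_rpow hm'.le (by positivity), ← neg_sub 1 s,
      Real.rpow_neg hm'.le, Real.rpow_neg (by positivity)]
    have hpow := (Real.rpow_pos_of_pos hm' (1 - s)).ne'
    field_simp
  obtain ⟨C, hC⟩ := (Metric.isBounded_range_of_tendsto _ hlim).exists_norm_le
  refine ⟨C, fun m => ?_⟩
  have hm : (0 : ℝ) < (m : ℝ) + 1 := by positivity
  have hCm := hC _ (mem_range_self m)
  rwa [Real.norm_eq_abs, abs_mul, abs_of_pos (Real.rpow_pos_of_pos hm _), ← neg_sub s 1,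
    Real.rpow_neg hm.le, ← div_eq_mul_inv, div_le_iff₀ (Real.rpow_pos_of_pos hm _)] at hCm

theorem tendsto_floor_div_atTop (hu : 0 < u) :
    Tendsto (fun h : ℝ => ⌊u / h⌋₊) (𝓝[>] 0) atTop :=
  tendsto_nat_floor_atTop.comp (tendsto_inv_nhdsGT_zero.const_mul_atTop hu)

theorem tendsto_floor_div_mul (hu : 0 ≤ u) :
    Tendsto (fun h : ℝ => ⌊u / h⌋₊ * h) (𝓝[>] 0) (𝓝 u) := by
  refine ((tendsto_nat_floor_mul_div_atTop hu).comp tendsto_inv_nhdsGT_zero).congr fun h => ?_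
  rw [Function.comp_apply, div_inv_eq_mul, ← div_eq_mul_inv]

theorem floor_div_mul_le {h : ℝ} (hu : 0 ≤ u) (hh : 0 < h) : ⌊u / h⌋₊ * h ≤ u :=
  (le_div_iff₀ hh).1 (Nat.floor_le (div_nonneg hu hh.le))

theorem tendsto_rpow_mul_multichoose_floor (hs : ∀ m : ℕ, s ≠ -m) (hu : 0 < u) :
    Tendsto (fun h : ℝ => h ^ (s - 1) * Ring.multichoose s ⌊u / h⌋₊) (𝓝[>] 0)
      (𝓝 (powerKernel s u)) := by
  have hpow : Tendsto (fun h : ℝ => (⌊u / h⌋₊ * h) ^ (s - 1)) (𝓝[>] 0) (𝓝 (u ^ (s - 1))) :=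
    (Real.continuousAt_rpow_const u (s - 1) (Or.inl hu.ne')).tendsto.comp
      (tendsto_floor_div_mul hu.le)
  refine (hpow.mul ((tendsto_multichoose_mul_rpow hs).comp (tendsto_floor_div_atTop hu))).congr' ?_
  filter_upwards [self_mem_nhdsWithin,
    (tendsto_floor_div_atTop hu).eventually (eventually_gt_atTop 0)] with h hh hN
  have hN' : (0 : ℝ) < ⌊u / h⌋₊ := by exact_mod_cast hN
  rw [Function.comp_apply, Real.mul_rpow hN'.le (le_of_lt hh), ← neg_sub s 1,
    Real.rpow_neg hN'.le]
  have hne := (Real.rpow_pos_of_pos hN' (s - 1)).ne'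
  field_simp

theorem exists_forall_abs_rpow_mul_multichoose_floor_le (hs : ∀ m : ℕ, s ≠ -m) (hs1 : s ≤ 1) :
    ∃ C, ∀ h, 0 < h → ∀ u, 0 < u →
      |h ^ (s - 1) * Ring.multichoose s ⌊u / h⌋₊| ≤ C * u ^ (s - 1) := by
  obtain ⟨C, hC⟩ := exists_forall_abs_multichoose_le hs
  have hC0 : 0 ≤ C := by simpa using (abs_nonneg _).trans (hC 0)
  refine ⟨C, fun h hh u hu => ?_⟩
  rw [abs_mul, abs_of_pos (Real.rpow_pos_of_pos hh _)]
  calc h ^ (s - 1) * |Ring.multichoose s ⌊u / h⌋₊|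
      ≤ h ^ (s - 1) * (C * ((⌊u / h⌋₊ : ℝ) + 1) ^ (s - 1)) := by gcongr; exact hC _
    _ ≤ h ^ (s - 1) * (C * (u / h) ^ (s - 1)) := by
        have hanti := Real.rpow_le_rpow_of_nonpos (div_pos hu hh)
          (Nat.lt_floor_add_one (u / h)).le (sub_nonpos.2 hs1)
        gcongr
    _ = C * u ^ (s - 1) := by
        rw [Real.div_rpow hu.le hh.le]
        have hne := (Real.rpow_pos_of_pos hh (s - 1)).ne'
        field_simp

end Multichoose

section RiemannSum

variable {E : Type*} [NormedAddCommGroup E] [NormedSpace ℝ E] {t : ℝ}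

theorem ae_lt_of_le (b : ℝ) : ∀ᵐ u : ℝ, u ≤ b → u < b := by
  filter_upwards [compl_mem_ae_iff.2 (measure_singleton b)] with u hne hu
  exact lt_of_le_of_ne hu hne

theorem tendsto_integral_of_dominated_of_tendsto {ι : Type*} {l : Filter ι}
    [l.IsCountablyGenerated] {F : ι → ℝ → E} {φ : ℝ → E} {bound : ℝ → ℝ} {b : ι → ℝ} {a c : ℝ}
    (hat : a < t) (htc : t < c) (hb : Tendsto b l (𝓝 t))
    (hmeas : ∀ᶠ i in l, AEStronglyMeasurable (F i) (volume.restrict (uIoc a c)))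
    (hbound : ∀ᶠ i in l, ∀ u ∈ Ioo a (b i), ‖F i u‖ ≤ bound u)
    (hint : IntervalIntegrable bound volume a c)
    (hlim : ∀ u ∈ Ioo a t, Tendsto (F · u) l (𝓝 (φ u))) :
    Tendsto (fun i => ∫ u in a..b i, F i u) l (𝓝 (∫ u in a..t, φ u)) := by
  have hDCT : Tendsto (fun i => ∫ u in a..c, {u | u ≤ b i}.indicator (F i) u) l
      (𝓝 (∫ u in a..c, {u | u ≤ t}.indicator φ u)) := by
    refine intervalIntegral.tendsto_integral_filter_of_dominated_convergence (fun u => |bound u|)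
      (hmeas.mono fun i hi => hi.indicator measurableSet_Iic) ?_ hint.abs ?_
    · filter_upwards [hbound] with i hi
      filter_upwards [ae_lt_of_le (b i)] with u hlt hu
      rw [uIoc_of_le (hat.trans htc).le] at hu
      by_cases hub : u ≤ b i
      · rw [indicator_of_mem (s := {u | u ≤ b i}) hub]
        exact (hi u ⟨hu.1, hlt hub⟩).trans (le_abs_self _)
      · rw [indicator_of_notMem (s := {u | u ≤ b i}) hub, norm_zero]
        exact abs_nonneg _
    · filter_upwards [ae_lt_of_le t] with u hlt hu
      rw [uIoc_of_le (hat.trans htc).le] at hu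
      by_cases hut : u ≤ t
      · rw [indicator_of_mem (s := {u | u ≤ t}) hut]
        refine (hlim u ⟨hu.1, hlt hut⟩).congr' ?_
        filter_upwards [hb.eventually_const_lt (hlt hut)] with i hi
        exact (indicator_of_mem (s := {u | u ≤ b i}) hi.le _).symm
      · rw [indicator_of_notMem (s := {u | u ≤ t}) hut]
        refine tendsto_const_nhds.congr' ?_
        filter_upwards [hb.eventually_lt_const (not_le.1 hut)] with i hi
        exact (indicator_of_notMem (s := {u | u ≤ b i}) (not_le.2 hi) _).symm
  rw [intervalIntegral.integral_indicator ⟨hat.le, htc.le⟩] at hDCT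
  refine hDCT.congr' ?_
  filter_upwards [hb.eventually_const_lt hat, hb.eventually_lt_const htc] with i hai hic
  exact intervalIntegral.integral_indicator ⟨hai.le, hic.le⟩

theorem integral_comp_floor_div [CompleteSpace E] {h : ℝ} (hh : 0 < h) (F : ℕ → E) (M : ℕ) :
    ∫ u in (0 : ℝ)..M * h, F ⌊u / h⌋₊ = h • ∑ r ∈ Finset.range M, F r := by
  have hcell : ∀ r : ℕ, EqOn (fun u => F ⌊u / h⌋₊) (fun _ => F r)
      (Ioo ((r : ℝ) * h) ((r + 1 : ℕ) * h)) := fun r u hu => by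
    have hfloor : ⌊u / h⌋₊ = r := (Nat.floor_eq_iff
      (div_nonneg (le_trans (by positivity) hu.1.le) hh.le)).2
      ⟨(le_div_iff₀ hh).2 hu.1.le, (div_lt_iff₀ hh).2 (by exact_mod_cast hu.2)⟩
    simp only [hfloor]
  have hle : ∀ r : ℕ, (r : ℝ) * h ≤ (r + 1 : ℕ) * h := fun r => by gcongr; simp
  have hcell_ae : ∀ r : ℕ, ∀ᵐ u, u ∈ uIoc ((r : ℝ) * h) ((r + 1 : ℕ) * h) →
      F ⌊u / h⌋₊ = F r := fun r => by
    filter_upwards [ae_lt_of_le ((r + 1 : ℕ) * h)] with u hlt hu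
    rw [uIoc_of_le (hle r)] at hu
    exact hcell r ⟨hu.1, hlt hu.2⟩
  have hint : ∀ r < M, IntervalIntegrable (fun u => F ⌊u / h⌋₊) volume
      ((r : ℝ) * h) ((r + 1 : ℕ) * h) := fun r _ =>
    (intervalIntegrable_const (c := F r)).congr_ae
      ((ae_restrict_iff' measurableSet_uIoc).2 ((hcell_ae r).mono fun u hu hm => (hu hm).symm))
  have hsum := intervalIntegral.sum_integral_adjacent_intervals
    (a := fun r : ℕ => (r : ℝ) * h) hint
  rw [Nat.cast_zero, zero_mul] at hsum
  rw [← hsum, Finset.smul_sum]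
  refine Finset.sum_congr rfl fun r _ => ?_
  rw [intervalIntegral.integral_congr_ae (hcell_ae r), intervalIntegral.integral_const,
    ← sub_mul, Nat.cast_succ, add_sub_cancel_left, one_mul]

theorem tendsto_smul_sum_range_floor [CompleteSpace E] (ht : 0 < t) {G : ℝ → ℕ → E} {φ : ℝ → E}
    {bound : ℝ → ℝ} (hint : IntervalIntegrable bound volume 0 (t + 1))
    (hbound : ∀ᶠ h in 𝓝[>] 0, ∀ u, 0 < u → ⌊u / h⌋₊ ≤ ⌊t / h⌋₊ → ‖G h ⌊u / h⌋₊‖ ≤ bound u)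
    (hlim : ∀ u ∈ Ioo 0 t, Tendsto (fun h => G h ⌊u / h⌋₊) (𝓝[>] 0) (𝓝 (φ u))) :
    Tendsto (fun h => h • ∑ r ∈ Finset.range (⌊t / h⌋₊ + 1), G h r) (𝓝[>] 0)
      (𝓝 (∫ u in 0..t, φ u)) := by
  have hend : Tendsto (fun h : ℝ => ((⌊t / h⌋₊ + 1 : ℕ) : ℝ) * h) (𝓝[>] 0) (𝓝 t) := by
    simpa [add_mul] using (tendsto_floor_div_mul ht.le).add
      (tendsto_id.mono_left nhdsWithin_le_nhds)
  have hmeas : ∀ h : ℝ, StronglyMeasurable fun u : ℝ => G h ⌊u / h⌋₊ := fun h =>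
    (StronglyMeasurable.of_discrete (f := G h)).comp_measurable
      (Nat.measurable_floor.comp (measurable_id.div_const h))
  refine (tendsto_integral_of_dominated_of_tendsto ht (lt_add_one t) hend
    (Eventually.of_forall fun h => (hmeas h).aestronglyMeasurable) ?_ hint hlim).congr' ?_
  · filter_upwards [hbound, self_mem_nhdsWithin] with h hG hh u hu
    exact hG u hu.1 (Nat.lt_succ_iff.1
      ((Nat.floor_lt (div_nonneg hu.1.le (le_of_lt hh))).2 ((div_lt_iff₀ hh).2 hu.2)))
  · filter_upwards [self_mem_nhdsWithin] with h hh using integral_comp_floor_div hh (G h) _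

theorem tendsto_rpow_mul_sum_multichoose {β : ℝ} (hβ0 : 0 < β) (hβ1 : β ≤ 1) (ht : 0 < t)
    {F : ℝ → ℕ → ℝ} {φ : ℝ → ℝ}
    (hbound : ∃ B, ∀ᶠ h in 𝓝[>] 0, ∀ r ≤ ⌊t / h⌋₊, |F h r| ≤ B)
    (hlim : ∀ u ∈ Ioo 0 t, Tendsto (fun h => F h ⌊u / h⌋₊) (𝓝[>] 0) (𝓝 (φ u))) :
    Tendsto (fun h : ℝ => h ^ β * ∑ r ∈ Finset.range (⌊t / h⌋₊ + 1),
        Ring.multichoose β r * F h r) (𝓝[>] 0)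
      (𝓝 (∫ u in 0..t, powerKernel β u * φ u)) := by
  have hβ : ∀ m : ℕ, β ≠ -m := fun m h => by linarith [m.cast_nonneg (α := ℝ)]
  obtain ⟨C, hC⟩ := exists_forall_abs_rpow_mul_multichoose_floor_le hβ hβ1
  obtain ⟨B, hB⟩ := hbound
  refine (tendsto_smul_sum_range_floor (bound := fun u => C * u ^ (β - 1) * B) ht
    (G := fun h r => h ^ (β - 1) * Ring.multichoose β r * F h r) ?_ ?_
    fun u hu => (tendsto_rpow_mul_multichoose_floor hβ hu.1).mul (hlim u hu)).congr' ?_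
  · exact ((intervalIntegral.intervalIntegrable_rpow' (by linarith)).const_mul C).mul_const B
  · filter_upwards [hB, self_mem_nhdsWithin] with h hF hh u hu hle
    rw [norm_mul]
    exact mul_le_mul (hC h hh u hu) (hF _ hle) (abs_nonneg _)
      ((abs_nonneg _).trans (hC h hh u hu))
  · filter_upwards [self_mem_nhdsWithin] with h hh
    rw [smul_eq_mul, Finset.mul_sum, Finset.mul_sum]
    refine Finset.sum_congr rfl fun r _ => ?_
    rw [Real.rpow_sub_one (ne_of_gt hh)]
    have hne : h ≠ 0 := ne_of_gt hh
    field_simp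

end RiemannSum

section FiniteDifference

theorem sum_multichoose_mul {R : Type*} [CommRing R] [BinomialRing R] (s : R) (f : ℕ → R)
    (N : ℕ) :
    ∑ r ∈ Finset.range (N + 1), Ring.multichoose s r * f r =
      Ring.multichoose (s + 1) N * f (N + 1) -
        ∑ r ∈ Finset.range (N + 1), Ring.multichoose (s + 1) r * Δ_[1] f r := by
  induction N with
  | zero => simp [fwdDiff]
  | succ N ih =>
    rw [Finset.sum_range_succ, ih, Finset.sum_range_succ _ (N + 1),
      Ring.multichoose_succ_succ s N, fwdDiff]
    ring

theorem sum_multichoose_mul_eq_sum_fwdDiff_iter {R : Type*} [CommRing R] [BinomialRing R]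
    (s : R) (f : ℕ → R) (N n : ℕ) :
    ∑ r ∈ Finset.range (N + 1), Ring.multichoose s r * f r =
      ∑ k ∈ Finset.range n, (-1) ^ k * Ring.multichoose (s + k + 1) N * (Δ_[1])^[k] f (N + 1) +
        (-1) ^ n * ∑ r ∈ Finset.range (N + 1), Ring.multichoose (s + n) r * (Δ_[1])^[n] f r := by
  induction n with
  | zero => simp
  | succ n ih =>
    rw [ih, Finset.sum_range_succ _ n, sum_multichoose_mul (s + n)]
    simp only [Function.iterate_succ_apply', Nat.cast_succ, ← add_assoc, pow_succ]
    ring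

theorem fwdDiff_iter_comp_add_nsmul {M G : Type*} [AddCommMonoid M] [AddCommGroup G] (f : M → G)
    (y h : M) (k r : ℕ) :
    (Δ_[1])^[k] (fun r : ℕ => f (y + r • h)) r = (Δ_[h])^[k] f (y + r • h) := by
  simp only [fwdDiff_iter_eq_sum_shift, smul_eq_mul, mul_one, add_smul, add_assoc]

theorem exists_fwdDiff_iter_eq_pow_mul_iteratedDeriv {k : ℕ} {f : ℝ → ℝ} (hf : ContDiff ℝ k f)
    (η t : ℝ) :
    ∃ θ ∈ Icc (0 : ℝ) k, (Δ_[η])^[k] f t = η ^ k * iteratedDeriv k f (t + θ * η) := by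
  induction k generalizing f with
  | zero => exact ⟨0, by simp, by simp⟩
  | succ k ih =>
    have hfk : ContDiff ℝ k f := hf.of_le (by exact_mod_cast k.le_succ)
    have hshift : ContDiff ℝ k fun z => f (z + η) := hfk.comp (by fun_prop)
    obtain ⟨θ, hθ, hdiff⟩ := ih (f := Δ_[η] f) (hshift.sub hfk)
    set ξ := t + θ * η
    have hsub : iteratedDeriv k (Δ_[η] f) ξ =
        iteratedDeriv k f (ξ + η) - iteratedDeriv k f ξ := by
      unfold fwdDiff
      rw [iteratedDeriv_fun_sub hshift.contDiffAt hfk.contDiffAt,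
        congrFun (iteratedDeriv_comp_add_const k f η) ξ]
    have hderiv : ∀ v, HasDerivAt (fun v => iteratedDeriv k f (ξ + v * η))
        (η * iteratedDeriv (k + 1) f (ξ + v * η)) v := fun v => by
      have hlin : HasDerivAt (fun v : ℝ => ξ + v * η) (1 * η) v :=
        ((hasDerivAt_id v).mul_const η).const_add ξ
      have hcomp := (hf.differentiable_iteratedDeriv k (by exact_mod_cast k.lt_succ_self)
        (ξ + v * η)).hasDerivAt.comp v hlin
      rwa [one_mul, mul_comm, ← iteratedDeriv_succ] at hcomp
    obtain ⟨v, hv, hslope⟩ := exists_hasDerivAt_eq_slope _ _ zero_lt_one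
      (HasDerivAt.continuousOn fun v _ => hderiv v) fun v _ => hderiv v
    refine ⟨θ + v, ⟨add_nonneg hθ.1 hv.1.le, ?_⟩, ?_⟩
    · rw [Nat.cast_succ]
      exact add_le_add hθ.2 hv.2.le
    · rw [sub_zero, div_one, one_mul, zero_mul, add_zero] at hslope
      rw [Function.iterate_succ_apply, hdiff, hsub, ← hslope, pow_succ, mul_assoc, add_mul,
        ← add_assoc]

theorem tendsto_fwdDiff_iter_div_pow {k : ℕ} {f : ℝ → ℝ} (hf : ContDiff ℝ k f) {ι : Type*}
    {l : Filter ι} {η τ : ι → ℝ} {t : ℝ} (hη : Tendsto η l (𝓝[≠] 0)) (hτ : Tendsto τ l (𝓝 t)) :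
    Tendsto (fun i => (Δ_[η i])^[k] f (τ i) / η i ^ k) l (𝓝 (iteratedDeriv k f t)) := by
  choose θ hθ hdiff using fun i => exists_fwdDiff_iter_eq_pow_mul_iteratedDeriv hf (η i) (τ i)
  obtain ⟨hη0, hne⟩ := tendsto_nhdsWithin_iff.1 hη
  have hpoint : Tendsto (fun i => τ i + θ i * η i) l (𝓝 t) := by
    simpa using hτ.add (bdd_le_mul_tendsto_zero' (k : ℝ) (Eventually.of_forall fun i =>
      (abs_of_nonneg (hθ i).1).trans_le (hθ i).2) hη0)
  refine (((hf.continuous_iteratedDeriv k le_rfl).tendsto t).comp hpoint).congr' ?_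
  filter_upwards [hne] with i hi
  rw [hdiff, mul_div_cancel_left₀ _ (pow_ne_zero k hi), Function.comp_apply]

end FiniteDifference

section GLDeriv

variable {a α t : ℝ} {g : ℝ → ℝ}

theorem glQuotient_eq (a α : ℝ) (g : ℝ → ℝ) (t : ℝ) (n : ℕ) {h : ℝ} (hh : 0 < h) :
    glQuotient a α g t h =
      ∑ k ∈ Finset.range n, h ^ ((k : ℝ) + 1 - α - 1) *
          Ring.multichoose ((k : ℝ) + 1 - α) ⌊(t - a) / h⌋₊ *
            ((Δ_[-h])^[k] g (t - ((⌊(t - a) / h⌋₊ : ℝ) + 1) * h) / (-h) ^ k) +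
        h ^ ((n : ℝ) - α) * ∑ r ∈ Finset.range (⌊(t - a) / h⌋₊ + 1),
          Ring.multichoose ((n : ℝ) - α) r * ((Δ_[-h])^[n] g (t - r * h) / (-h) ^ n) := by
  have hpow : ∀ k : ℕ, h ^ ((k : ℝ) - α) = h ^ (-α) * h ^ k := fun k => by
    rw [sub_eq_neg_add, Real.rpow_add_natCast hh.ne']
  have hsign : ∀ k : ℕ, (-1 : ℝ) ^ k = h ^ k / (-h) ^ k := fun k => by
    rw [← div_pow, div_neg, div_self hh.ne']
  have hdiff : ∀ k r : ℕ, (Δ_[1])^[k] (fun r : ℕ => g (t - r * h)) r =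
      (Δ_[-h])^[k] g (t - r * h) := fun k r => by
    simpa [← sub_eq_add_neg] using fwdDiff_iter_comp_add_nsmul g t (-h) k r
  simp only [glQuotient, neg_one_pow_mul_choose]
  rw [sum_multichoose_mul_eq_sum_fwdDiff_iter (-α) (fun r : ℕ => g (t - r * h)) _ n, mul_add,
    Finset.mul_sum, Finset.mul_sum, Finset.mul_sum, Finset.mul_sum]
  simp only [hdiff, hpow, Nat.cast_succ]
  congr! 2 with k _ r _
  · rw [show (k : ℝ) + 1 - α - 1 = k - α by ring, hpow, hsign,
      show -α + k + 1 = k + 1 - α by ring]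
    ring
  · rw [neg_add_eq_sub, hsign]
    ring

theorem tendsto_neg_nhdsGT_zero : Tendsto (fun h : ℝ => -h) (𝓝[>] 0) (𝓝[≠] 0) := by
  refine tendsto_nhdsWithin_iff.2 ⟨?_, ?_⟩
  · simpa using (continuous_neg.tendsto (0 : ℝ)).mono_left nhdsWithin_le_nhds
  · filter_upwards [self_mem_nhdsWithin] with h hh using neg_ne_zero.2 (ne_of_gt hh)

theorem exists_eventually_abs_fwdDiff_iter_div_pow_le {n : ℕ} (hg : ContDiff ℝ n g) (ht : a < t) :
    ∃ B, ∀ᶠ h in 𝓝[>] 0, ∀ r ≤ ⌊(t - a) / h⌋₊,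
      |(Δ_[-h])^[n] g (t - r * h) / (-h) ^ n| ≤ B := by
  obtain ⟨B, hB⟩ := (isCompact_Icc (a := a - n) (b := t)).exists_bound_of_continuousOn
    (hg.continuous_iteratedDeriv n le_rfl).continuousOn
  refine ⟨B, ?_⟩
  filter_upwards [Ioo_mem_nhdsGT (zero_lt_one (α := ℝ))] with h hh r hr
  obtain ⟨θ, hθ, hdiff⟩ := exists_fwdDiff_iter_eq_pow_mul_iteratedDeriv hg (-h) (t - r * h)
  rw [hdiff, mul_div_cancel_left₀ _ (pow_ne_zero n (neg_ne_zero.2 hh.1.ne'))]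
  have hrh : r * h ≤ t - a := le_trans (by have := hh.1; gcongr)
    (floor_div_mul_le (sub_pos.2 ht).le hh.1)
  have hθh : θ * h ≤ n := (mul_le_of_le_one_right hθ.1 hh.2.le).trans hθ.2
  refine hB _ ⟨by linarith, ?_⟩
  have := mul_nonneg hθ.1 hh.1.le
  have := mul_nonneg (r.cast_nonneg (α := ℝ)) hh.1.le
  linarith

theorem hasGLDerivAt_rlDeriv (hα : 0 < α) (hαN : ∀ m : ℕ, α ≠ m) (hg : ContDiff ℝ (ord α) g)
    (ht : a < t) : HasGLDerivAt a α g (rlDeriv a α g t) t := by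
  have hta : 0 < t - a := sub_pos.2 ht
  have hend : Tendsto (fun h : ℝ => t - ((⌊(t - a) / h⌋₊ : ℝ) + 1) * h) (𝓝[>] 0) (𝓝 a) := by
    simpa [add_mul] using ((tendsto_floor_div_mul hta.le).add
      (tendsto_id.mono_left nhdsWithin_le_nhds)).const_sub t
  have hboundary : ∀ k ∈ Finset.range (ord α), Tendsto (fun h : ℝ =>
      h ^ ((k : ℝ) + 1 - α - 1) * Ring.multichoose ((k : ℝ) + 1 - α) ⌊(t - a) / h⌋₊ *
        ((Δ_[-h])^[k] g (t - ((⌊(t - a) / h⌋₊ : ℝ) + 1) * h) / (-h) ^ k)) (𝓝[>] 0)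
      (𝓝 (powerKernel (k + 1 - α) (t - a) * iteratedDeriv k g a)) := fun k hk =>
    (tendsto_rpow_mul_multichoose_floor (natCast_add_one_sub_ne_neg hαN k) hta).mul
      (tendsto_fwdDiff_iter_div_pow (hg.of_le (by exact_mod_cast (Finset.mem_range.1 hk).le))
        tendsto_neg_nhdsGT_zero hend)
  have hmain := tendsto_rpow_mul_sum_multichoose (ord_sub_pos α) (ord_sub_lt_one hα hαN).le hta
    (exists_eventually_abs_fwdDiff_iter_div_pow_le hg ht) fun u hu =>
      tendsto_fwdDiff_iter_div_pow hg tendsto_neg_nhdsGT_zero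
        ((tendsto_floor_div_mul hu.1.le).const_sub t)
  have hsum := (tendsto_finsetSum _ hboundary).add hmain
  rw [← rlIntegral_eq_integral_comp_sub, ← caputoDeriv_eq_rlIntegral] at hsum
  simp only [mul_comm (powerKernel _ _)] at hsum
  rw [← rlDeriv_eq_sum_add_caputoDeriv hg ht] at hsum
  exact hsum.congr' (eventually_mem_nhdsWithin.mono fun h hh => (glQuotient_eq a α g t _ hh).symm)

end GLDeriv

section MomentProblem

open Polynomial

theorem exists_polynomial_comp_near_of_injOn {X : Type*} [TopologicalSpace X] {K : Set X}
    (hK : IsCompact K) {φ f : X → ℝ} (hφ : ContinuousOn φ K) (hinj : InjOn φ K)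
    (hf : ContinuousOn f K) {ε : ℝ} (hε : 0 < ε) :
    ∃ P : ℝ[X], ∀ x ∈ K, |P.eval (φ x) - f x| < ε := by
  have : CompactSpace K := isCompact_iff_compactSpace.1 hK
  let Φ : C(K, ℝ) := ⟨K.domRestrict φ, hφ.domRestrict⟩
  have hsep : (Algebra.adjoin ℝ {Φ}).SeparatesPoints := fun x y hxy =>
    ⟨Φ, mem_image_of_mem _ (Algebra.self_mem_adjoin_singleton ℝ Φ),
      fun h => hxy (Subtype.ext (hinj x.2 y.2 h))⟩
  obtain ⟨⟨p, hp⟩, hnear⟩ :=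
    ContinuousMap.exists_mem_subalgebra_near_continuous_of_separatesPoints _ hsep
      (K.domRestrict f) hf.domRestrict ε hε
  obtain ⟨P, rfl⟩ := Algebra.adjoin_singleton_eq_range_aeval ℝ Φ ▸ hp
  refine ⟨P, fun x hx => ?_⟩
  have heval : aeval Φ P ⟨x, hx⟩ = P.eval (φ x) := by
    rw [aeval_continuousMap_apply]
    rfl
  rw [← heval]
  exact hnear ⟨x, hx⟩

theorem eqOn_zero_of_forall_integral_pow_mul_eq_zero {a b : ℝ} (hab : a < b) {φ f : ℝ → ℝ}
    (hφ : ContinuousOn φ (Icc a b)) (hinj : InjOn φ (Icc a b)) (hf : ContinuousOn f (Icc a b))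
    (h : ∀ k : ℕ, ∫ u in a..b, φ u ^ k * f u = 0) : EqOn f 0 (Icc a b) := by
  have hint : ∀ {g : ℝ → ℝ}, ContinuousOn g (Icc a b) → IntervalIntegrable g volume a b :=
    fun hg => ContinuousOn.intervalIntegrable (by rwa [uIcc_of_le hab.le])
  have hpoly : ∀ P : ℝ[X], ∫ u in a..b, P.eval (φ u) * f u = 0 := fun P => by
    simp only [eval_eq_sum_range, Finset.sum_mul, mul_assoc]
    rw [intervalIntegral.integral_finsetSum fun k _ => hint (by fun_prop)]
    simp only [intervalIntegral.integral_const_mul, h, mul_zero, Finset.sum_const_zero]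
  have hle : ∀ ε > 0, ∫ u in a..b, f u * f u ≤ ε * ∫ u in a..b, |f u| := fun ε hε => by
    obtain ⟨P, hP⟩ := exists_polynomial_comp_near_of_injOn isCompact_Icc hφ hinj hf hε
    have : ContinuousOn (fun u => P.eval (φ u)) (Icc a b) := P.continuous.comp_continuousOn hφ
    calc ∫ u in a..b, f u * f u
        = ∫ u in a..b, (f u * f u - P.eval (φ u) * f u) := by
          rw [intervalIntegral.integral_sub (hint (by fun_prop)) (hint (by fun_prop)), hpoly,
            sub_zero]
      _ ≤ ∫ u in a..b, ε * |f u| := by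
          refine intervalIntegral.integral_mono_on hab.le
            (hint (by fun_prop)) (hint (by fun_prop)) fun u hu => ?_
          rw [← sub_mul]
          refine (le_abs_self _).trans ?_
          rw [abs_mul, abs_sub_comm]
          exact mul_le_mul_of_nonneg_right (hP u hu).le (abs_nonneg _)
      _ = ε * ∫ u in a..b, |f u| := intervalIntegral.integral_const_mul _ _
  have hsq : ∫ u in a..b, f u * f u ≤ 0 := by
    have hlim : Tendsto (fun ε => ε * ∫ u in a..b, |f u|) (𝓝[>] 0) (𝓝 (0 * ∫ u in a..b, |f u|)) :=
      (tendsto_id.mono_left nhdsWithin_le_nhds).mul_const _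
    rw [zero_mul] at hlim
    exact ge_of_tendsto hlim (eventually_mem_nhdsWithin.mono hle)
  intro u hu
  by_contra hne
  exact hsq.not_gt (intervalIntegral.integral_pos hab (hf.mul hf)
    (fun v _ => mul_self_nonneg _) ⟨u, hu, mul_self_pos.2 hne⟩)

end MomentProblem

section ShiftedKernel

variable {β T : ℝ} {w : ℝ → ℝ}

theorem hasDerivAt_integral_mul_powerKernel_add (hT : 0 ≤ T)
    (hw : IntervalIntegrable w volume 0 T) (β : ℝ) {t : ℝ} (ht : 0 < t) :
    HasDerivAt (fun t => ∫ u in (0 : ℝ)..T, w u * powerKernel β (t + u))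
      (∫ u in (0 : ℝ)..T, w u * powerKernel (β - 1) (t + u)) t := by
  have hne : ∀ t ∈ Ioi (0 : ℝ), ∀ u ∈ uIcc 0 T, t + u ≠ 0 := fun t ht u hu => by
    rw [uIcc_of_le hT] at hu
    exact (add_pos_of_pos_of_nonneg ht hu.1).ne'
  have hcont : ∀ γ, ContinuousOn (Function.uncurry fun t u => powerKernel γ (t + u))
      (Ioi 0 ×ˢ uIcc 0 T) := fun γ z hz =>
    ((hasDerivAt_powerKernel γ (hne z.1 hz.1 z.2 hz.2)).continuousAt.comp
      (f := fun z : ℝ × ℝ => z.1 + z.2) continuous_add.continuousAt).continuousWithinAt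
  exact hasDerivAt_integral_smul (k := w) isOpen_Ioi hw (hcont β) (hcont (β - 1))
    (fun t ht u hu => (hasDerivAt_powerKernel β (hne t ht u hu)).comp_add_const t u) ht

theorem integral_mul_powerKernel_sub_natCast_eq_zero (hT : 0 ≤ T)
    (hw : IntervalIntegrable w volume 0 T)
    (h : ∀ t > 0, ∫ u in (0 : ℝ)..T, w u * powerKernel β (t + u) = 0) (k : ℕ) {t : ℝ}
    (ht : 0 < t) : ∫ u in (0 : ℝ)..T, w u * powerKernel (β - k) (t + u) = 0 := by
  induction k generalizing t with
  | zero => simpa using h t ht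
  | succ k ih =>
    have hzero : (fun t => ∫ u in (0 : ℝ)..T, w u * powerKernel (β - k) (t + u)) =ᶠ[𝓝 t] 0 := by
      filter_upwards [Ioi_mem_nhds ht] with s hs using ih hs
    have hderiv := (hasDerivAt_integral_mul_powerKernel_add hT hw (β - k) ht).deriv
    rw [Nat.cast_succ, ← sub_sub, ← hderiv, hzero.deriv_eq]
    exact deriv_const t 0

theorem eqOn_zero_of_forall_integral_mul_powerKernel_eq_zero (hβ : ∀ m : ℤ, β ≠ m) (hT : 0 < T)
    (hw : ContinuousOn w (Icc 0 T))
    (h : ∀ t > 0, ∫ u in (0 : ℝ)..T, w u * powerKernel β (t + u) = 0) :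
    EqOn w 0 (Icc 0 T) := by
  have hpos : ∀ u ∈ Icc 0 T, 0 < 1 + u := fun u hu => add_pos_of_pos_of_nonneg one_pos hu.1
  have hmoment : ∀ k : ℕ,
      ∫ u in (0 : ℝ)..T, (1 + u)⁻¹ ^ k * (w u * (1 + u) ^ (β - 1)) = 0 := fun k => by
    have hΓ : Real.Gamma (β - k) ≠ 0 := Real.Gamma_ne_zero fun m hm =>
      hβ (k - m) (by push_cast; linarith)
    have hk := congrArg (Real.Gamma (β - k) * ·) <| integral_mul_powerKernel_sub_natCast_eq_zero
      hT.le (hw.intervalIntegrable_of_Icc hT.le) h k one_pos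
    simp only [mul_zero, ← intervalIntegral.integral_const_mul] at hk
    refine (intervalIntegral.integral_congr fun u hu => ?_).trans hk
    rw [uIcc_of_le hT.le] at hu
    have hu' := hpos u hu
    simp only [powerKernel, sub_right_comm β (k : ℝ) 1, Real.rpow_sub_natCast hu'.ne', inv_pow]
    field_simp
  have hzero := eqOn_zero_of_forall_integral_pow_mul_eq_zero hT
    (φ := fun u => (1 + u)⁻¹) (ContinuousOn.inv₀ (by fun_prop) fun u hu => (hpos u hu).ne')
    (fun u _ v _ huv => add_left_cancel (inv_injective huv))
    (hw.mul (ContinuousOn.rpow_const (by fun_prop) fun u hu => Or.inl (hpos u hu).ne')) hmoment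
  exact fun u hu => (mul_eq_zero.1 (hzero hu)).resolve_right
    (Real.rpow_pos_of_pos (hpos u hu) _).ne'

end ShiftedKernel

section Periodic

variable {a α β T : ℝ} {f g z : ℝ → ℝ}

/-- `f`, regarded as a function on `(a, ∞)`, is `T`-periodic. It is `PeriodicOnPos` for the
fractional derivatives based at an arbitrary point. -/
def PeriodicOnIoi (a T : ℝ) (f : ℝ → ℝ) : Prop :=
  ∀ t, a < t → f (t + T) = f t

theorem PeriodicOnIoi.congr (hT : 0 ≤ T) (hf : PeriodicOnIoi a T f) (h : EqOn f g (Ioi a)) :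
    PeriodicOnIoi a T g := fun t ht => by
  rw [← h ht, ← h (lt_add_of_lt_of_nonneg ht hT), hf t ht]

theorem rlIntegral_add_period_sub (hβ : 0 < β) (hz : Continuous z) (hper : Function.Periodic z T)
    (a t : ℝ) :
    rlIntegral a β z (t + T) - rlIntegral a β z t =
      ∫ u in (0 : ℝ)..T, z (a - u) * powerKernel β (t - a + u) := by
  have hint : ∀ b, IntervalIntegrable (fun u => powerKernel β u * z (t - u)) volume 0 b :=
    fun b => (intervalIntegrable_powerKernel hβ 0 b).mul_continuousOn
      (Continuous.continuousOn (by fun_prop))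
  have hshift := intervalIntegral.integral_comp_add_left (a := 0) (b := T)
    (fun u => powerKernel β u * z (t - u)) (t - a)
  simp only [rlIntegral_eq_integral_comp_sub, add_sub_right_comm t T, hper _]
  rw [add_zero] at hshift
  rw [intervalIntegral.integral_interval_sub_left (hint _) (hint _), ← hshift]
  refine intervalIntegral.integral_congr fun u _ => ?_
  simp only [← sub_sub, sub_sub_cancel, mul_comm]

theorem eq_zero_of_periodicOnIoi_rlIntegral (hβ : ∀ m : ℤ, β ≠ m) (hβ0 : 0 < β) (hT : 0 < T)
    (hz : Continuous z) (hper : Function.Periodic z T)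
    (h : PeriodicOnIoi a T (rlIntegral a β z)) : z = 0 := by
  have hzero := eqOn_zero_of_forall_integral_mul_powerKernel_eq_zero (w := fun u => z (a - u)) hβ hT
    (Continuous.continuousOn (by fun_prop)) fun t ht => by
      rw [← add_sub_cancel_left a t, ← rlIntegral_add_period_sub hβ0 hz hper, sub_eq_zero]
      exact h _ (lt_add_of_pos_right a ht)
  funext s
  obtain ⟨v, hv, hvs⟩ := hper.exists_mem_Ico hT s (a - T)
  rw [hvs, ← sub_sub_cancel a v]
  exact hzero ⟨by linarith [hv.2], by linarith [hv.1]⟩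

theorem eq_zero_of_iteratedDeriv_eq_zero {n : ℕ} (hg : ContDiff ℝ n g)
    (hn : iteratedDeriv n g = 0) (h0 : ∀ k < n, iteratedDeriv k g a = 0) : g = 0 := by
  induction n generalizing g with
  | zero => rwa [iteratedDeriv_zero] at hn
  | succ n ih =>
    have hg' : ContDiff ℝ n (deriv g) := (contDiff_succ_iff_deriv.1 (by exact_mod_cast hg)).2.2
    have hderiv : deriv g = 0 := ih hg' (by rwa [← iteratedDeriv_succ'])
      fun k hk => by rw [← iteratedDeriv_succ']; exact h0 (k + 1) (Nat.succ_lt_succ hk)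
    funext s
    rw [is_const_of_deriv_eq_zero (hg.differentiable (by simp)) (congrFun hderiv) s a]
    exact h0 0 n.succ_pos

theorem periodic_iteratedDeriv (h : Function.Periodic g T) (k : ℕ) :
    Function.Periodic (iteratedDeriv k g) T := fun t => by
  rw [← congrFun (iteratedDeriv_comp_add_const k g T) t, funext h]

theorem PeriodicOnIoi.tendsto_nhdsGT (hT : 0 < T) (hf : PeriodicOnIoi a T f)
    (hcont : ContinuousOn f (Ioi a)) : Tendsto f (𝓝[>] a) (𝓝 (f (a + T))) := by
  have hshift : Tendsto (fun t => f (t + T)) (𝓝 a) (𝓝 (f (a + T))) :=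
    (hcont.continuousAt (Ioi_mem_nhds (lt_add_of_pos_right a hT))).tendsto.comp
      ((continuous_add_const T).tendsto a)
  refine (hshift.mono_left nhdsWithin_le_nhds).congr' ?_
  filter_upwards [self_mem_nhdsWithin] with t ht using hf t ht

theorem iteratedDeriv_eq_zero_of_periodicOnIoi_rlDeriv (hα : 0 < α) (hαN : ∀ m : ℕ, α ≠ m)
    (hT : 0 < T) (hg : ContDiff ℝ (ord α) g) (h : PeriodicOnIoi a T (rlDeriv a α g)) :
    ∀ k < ord α, iteratedDeriv k g a = 0 := by
  by_contra! hne
  have hlim := h.tendsto_nhdsGT hT (continuousOn_rlDeriv hg a)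
  exact (tendsto_rlDeriv_atTop_or_atBot hα hαN hg hne).elim
    (fun h => not_tendsto_nhds_of_tendsto_atTop h _ hlim)
    (fun h => not_tendsto_nhds_of_tendsto_atBot h _ hlim)

theorem eq_zero_of_periodicOnIoi_rlDeriv (hα : 0 < α) (hαN : ∀ m : ℕ, α ≠ m) (hT : 0 < T)
    (hg : ContDiff ℝ (ord α) g) (hper : Function.Periodic g T)
    (h : PeriodicOnIoi a T (rlDeriv a α g)) : g = 0 := by
  have h0 := iteratedDeriv_eq_zero_of_periodicOnIoi_rlDeriv hα hαN hT hg h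
  have hβ : ∀ m : ℤ, (ord α : ℝ) - α ≠ m := fun m hm => by
    have hpos : (0 : ℝ) < m := hm ▸ ord_sub_pos α
    have hlt : (m : ℝ) < 1 := hm ▸ ord_sub_lt_one hα hαN
    norm_cast at hpos hlt
    omega
  have hcaputo : PeriodicOnIoi a T (rlIntegral a (ord α - α) (iteratedDeriv (ord α) g)) :=
    h.congr hT.le fun t ht => by rw [rlDeriv_eq_caputoDeriv hg h0 ht, caputoDeriv_eq_rlIntegral]
  exact eq_zero_of_iteratedDeriv_eq_zero hg (eq_zero_of_periodicOnIoi_rlIntegral hβ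
    (ord_sub_pos α) hT (hg.continuous_iteratedDeriv _ le_rfl) (periodic_iteratedDeriv hper _)
    hcaputo) h0

end Periodic

section Extension

variable {a α T : ℝ} {f g : ℝ → ℝ}

theorem PeriodicOnIoi.add_nat_mul (hT : 0 ≤ T) (hf : PeriodicOnIoi a T f) (k : ℕ) {t : ℝ}
    (ht : a < t) : f (t + k * T) = f t := by
  induction k with
  | zero => simp
  | succ k ih =>
    rw [← ih, ← hf (t + k * T) (lt_add_of_lt_of_nonneg ht (by positivity)), Nat.cast_succ,
      add_one_mul, add_assoc]

theorem PeriodicOnIoi.comp_toIocMod_eqOn (hT : 0 < T) (hf : PeriodicOnIoi a T f) :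
    EqOn (fun t => f (toIocMod hT a t)) f (Ioi a) := fun t ht => by
  have hnonneg : 0 ≤ toIocDiv hT a t := by
    have hlt : -1 * T < toIocDiv hT a t * T := by
      rw [← zsmul_eq_mul, ← self_sub_toIocMod]
      linarith [toIocMod_le_right hT a t, mem_Ioi.1 ht]
    have hdiv : (-1 : ℝ) < toIocDiv hT a t := lt_of_mul_lt_mul_right hlt hT.le
    exact_mod_cast hdiv
  obtain ⟨k, hk⟩ := Int.eq_ofNat_of_zero_le hnonneg
  have hmod := toIocMod_add_toIocDiv_zsmul hT a t
  rw [hk, zsmul_eq_mul, Int.cast_natCast] at hmod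
  exact (hf.add_nat_mul hT.le k (left_lt_toIocMod hT a t)).symm.trans (congrArg f hmod)

theorem contDiff_of_periodic {n : ℕ} (hT : 0 < T) (hper : Function.Periodic f T)
    (hf : ContDiffOn ℝ n f (Ioi a)) : ContDiff ℝ n f := by
  refine contDiff_iff_contDiffAt.2 fun t => ?_
  obtain ⟨k, hk⟩ := exists_lt_nsmul hT (a - t)
  have hshift : f = fun s => f (s + k • T) := funext fun s => ((hper.nsmul k) s).symm
  rw [hshift]
  exact (hf.contDiffAt (Ioi_mem_nhds (by linarith))).comp t (f := fun s => s + k • T)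
    (by fun_prop)

theorem exists_periodic_contDiff_eqOn {n : ℕ} (hT : 0 < T) (hf : ContDiffOn ℝ n f (Ioi a))
    (hper : PeriodicOnIoi a T f) :
    ∃ g, ContDiff ℝ n g ∧ Function.Periodic g T ∧ EqOn f g (Ioi a) := by
  have heq := hper.comp_toIocMod_eqOn hT
  have hper' : Function.Periodic (fun t => f (toIocMod hT a t)) T :=
    (toIocMod_periodic hT a).comp f
  exact ⟨_, contDiff_of_periodic hT hper' (hf.congr heq), hper', heq.symm⟩

theorem kernelIntegral_congr (α : ℝ) (h : EqOn f g (Ioi a)) :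
    EqOn (kernelIntegral a α f) (kernelIntegral a α g) (Ioi a) := fun t ht => by
  refine intervalIntegral.integral_congr_ae (Eventually.of_forall fun s hs => ?_)
  rw [uIoc_of_le (le_of_lt ht)] at hs
  rw [h hs.1]

theorem rlDeriv_congr (α : ℝ) (h : EqOn f g (Ioi a)) :
    EqOn (rlDeriv a α f) (rlDeriv a α g) (Ioi a) := fun t ht => by
  rw [rlDeriv, rlDeriv, (kernelIntegral_congr α h).iteratedDeriv_of_isOpen isOpen_Ioi _ ht]

theorem caputoDeriv_congr (α : ℝ) (h : EqOn f g (Ioi a)) :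
    EqOn (caputoDeriv a α f) (caputoDeriv a α g) (Ioi a) := fun t ht => by
  rw [caputoDeriv, caputoDeriv,
    kernelIntegral_congr α (h.iteratedDeriv_of_isOpen isOpen_Ioi _) ht]

theorem glQuotient_sub_glQuotient (α : ℝ) (hfg : EqOn f g (Ioi a)) {t h : ℝ} (ht : a < t)
    (hh : 0 < h) :
    glQuotient a α f t h - glQuotient a α g t h =
      h ^ (-α - 1) * Ring.multichoose (-α) ⌊(t - a) / h⌋₊ *
        (h * (f (t - ⌊(t - a) / h⌋₊ * h) - g (t - ⌊(t - a) / h⌋₊ * h))) := by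
  have hle := floor_div_mul_le (sub_pos.2 ht).le hh
  have hmem : ∀ r ∈ Finset.range ⌊(t - a) / h⌋₊, f (t - r * h) = g (t - r * h) := fun r hr => by
    have hr' : (r : ℝ) * h < ⌊(t - a) / h⌋₊ * h :=
      mul_lt_mul_of_pos_right (by exact_mod_cast Finset.mem_range.1 hr) hh
    exact hfg (mem_Ioi.2 (by linarith))
  simp only [glQuotient, neg_one_pow_mul_choose, Finset.sum_range_succ]
  rw [Finset.sum_congr rfl fun r hr => by rw [hmem r hr], Real.rpow_sub_one hh.ne']
  field_simp
  ring

theorem eventually_abs_sub_le_of_eqOn (hfg : EqOn f g (Ioi a)) {t : ℝ} (ht : a < t) :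
    ∀ᶠ h in 𝓝[>] 0, |f (t - ⌊(t - a) / h⌋₊ * h) - g (t - ⌊(t - a) / h⌋₊ * h)| ≤ |f a - g a| := by
  filter_upwards [self_mem_nhdsWithin] with h hh
  rcases (floor_div_mul_le (sub_pos.2 ht).le hh).eq_or_lt with heq | hlt
  · rw [heq, sub_sub_cancel]
  · rw [hfg (mem_Ioi.2 (by linarith)), sub_self, abs_zero]
    exact abs_nonneg _

theorem HasGLDerivAt.congr (hαN : ∀ m : ℕ, α ≠ m) (hfg : EqOn f g (Ioi a)) {L t : ℝ}
    (ht : a < t) (hf : HasGLDerivAt a α f L t) : HasGLDerivAt a α g L t := by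
  have hcoef := tendsto_rpow_mul_multichoose_floor (s := -α)
    (fun m hm => hαN m (neg_injective hm)) (sub_pos.2 ht)
  have hlast : Tendsto (fun h : ℝ => h * (f (t - ⌊(t - a) / h⌋₊ * h) -
      g (t - ⌊(t - a) / h⌋₊ * h))) (𝓝[>] 0) (𝓝 0) := by
    simp only [mul_comm (_ : ℝ) (f _ - g _)]
    exact bdd_le_mul_tendsto_zero' _ (eventually_abs_sub_le_of_eqOn hfg ht)
      (tendsto_id.mono_left nhdsWithin_le_nhds)
  have hsub := Tendsto.sub hf (hcoef.mul hlast)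
  rw [mul_zero, sub_zero] at hsub
  refine hsub.congr' ?_
  filter_upwards [self_mem_nhdsWithin] with h hh
  rw [← glQuotient_sub_glQuotient α hfg ht hh, sub_sub_cancel]

theorem tendsto_iteratedDeriv_nhdsGT_of_eqOn {n k : ℕ} (hg : ContDiff ℝ n g)
    (hfg : EqOn f g (Ioi a)) (hk : k ≤ n) :
    Tendsto (iteratedDeriv k f) (𝓝[>] a) (𝓝 (iteratedDeriv k g a)) := by
  have hcont := hg.continuous_iteratedDeriv k (by exact_mod_cast hk)
  refine ((hcont.tendsto a).mono_left nhdsWithin_le_nhds).congr' ?_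
  filter_upwards [self_mem_nhdsWithin] with t ht
  exact (hfg.iteratedDeriv_of_isOpen isOpen_Ioi k ht).symm

theorem not_periodicOnIoi_rlDeriv (hα : 0 < α) (hαN : ∀ m : ℕ, α ≠ m) (hT : 0 < T)
    (hf : ContDiffOn ℝ (ord α) f (Ioi a)) (hper : PeriodicOnIoi a T f)
    (hne : ∃ s, a < s ∧ f s ≠ 0) : ¬ PeriodicOnIoi a T (rlDeriv a α f) := fun h => by
  obtain ⟨g, hg, hgper, hfg⟩ := exists_periodic_contDiff_eqOn hT hf hper
  obtain ⟨s, hs, hne⟩ := hne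
  have hg0 := eq_zero_of_periodicOnIoi_rlDeriv hα hαN hT hg hgper
    (h.congr hT.le (rlDeriv_congr α hfg))
  exact hne ((hfg hs).trans (congrFun hg0 s))

end Extension

end FracDeriv

open FracDeriv in
theorem corollary1_general (α : ℝ) (hα : 0 < α) (hαN : ∀ m : ℕ, α ≠ m) (a T : ℝ) (hT : 0 < T)
    (x : ℝ → ℝ) (hx : ContDiffOn ℝ (ord α) x (Ioi a)) (hper : PeriodicOnIoi a T x)
    (hne : ∃ s, a < s ∧ x s ≠ 0) :
    (ContDiffOn ℝ (ord α) (kernelIntegral a α x) (Ioi a) ∧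
      ¬ PeriodicOnIoi a T (rlDeriv a α x)) ∧
    ((∀ t, a < t → HasGLDerivAt a α x (glDeriv a α x t) t) ∧
      (∀ t, a < t → glDeriv a α x t = rlDeriv a α x t) ∧
      ¬ PeriodicOnIoi a T (glDeriv a α x)) ∧
    (∃ c : ℕ → ℝ,
      (∀ k < ord α, Tendsto (iteratedDeriv k x) (𝓝[>] a) (𝓝 (c k))) ∧
      ((∃ k < ord α, c k ≠ 0) →
        Tendsto (rlDeriv a α x) (𝓝[>] a) atTop ∨ Tendsto (rlDeriv a α x) (𝓝[>] a) atBot) ∧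
      ((∀ k < ord α, c k = 0) →
        (∀ t, a < t → rlDeriv a α x t = caputoDeriv a α x t) ∧
        ¬ PeriodicOnIoi a T (caputoDeriv a α x))) := by
  obtain ⟨y, hy, -, hxy⟩ := exists_periodic_contDiff_eqOn hT hx hper
  have hrl := rlDeriv_congr α hxy
  have hnot := not_periodicOnIoi_rlDeriv hα hαN hT hx hper hne
  have hgl : ∀ t, a < t → HasGLDerivAt a α x (rlDeriv a α x t) t := fun t ht =>
    hrl ht ▸ (hasGLDerivAt_rlDeriv hα hαN hy ht).congr hαN hxy.symm ht
  have hgl_eq : EqOn (glDeriv a α x) (rlDeriv a α x) (Ioi a) := fun t ht => (hgl t ht).limUnder_eq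
  refine ⟨⟨(contDiffOn_kernelIntegral hy a).congr (kernelIntegral_congr α hxy), hnot⟩,
    ⟨fun t ht => (hgl_eq ht).symm ▸ hgl t ht, hgl_eq, fun h => hnot (h.congr hT.le hgl_eq)⟩,
    fun k => iteratedDeriv k y a,
    fun k hk => tendsto_iteratedDeriv_nhdsGT_of_eqOn hy hxy hk.le, fun hc => ?_, fun h0 => ?_⟩
  · have heq : rlDeriv a α y =ᶠ[𝓝[>] a] rlDeriv a α x :=
      hrl.symm.eventuallyEq_of_mem self_mem_nhdsWithin
    exact (tendsto_rlDeriv_atTop_or_atBot hα hαN hy hc).imp (·.congr' heq) (·.congr' heq)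
  · have hcap : EqOn (rlDeriv a α x) (caputoDeriv a α x) (Ioi a) := fun t ht =>
      (hrl ht).trans ((rlDeriv_eq_caputoDeriv hy h0 ht).trans (caputoDeriv_congr α hxy ht).symm)
    exact ⟨hcap, fun h => hnot (h.congr hT.le hcap.symm)⟩

theorem corollary1 (α : ℝ) (hα : 0 < α) (hαN : ∀ m : ℕ, α ≠ (m : ℝ))
    (T : ℝ) (hT : 0 < T) (x : ℝ → ℝ)
    (hx : ContDiffOn ℝ (FracDeriv.ord α : ℕ) x (Set.Ioi 0))
    (hper : FracDeriv.PeriodicOnPos T x)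
    (hnc : ∃ s t : ℝ, 0 < s ∧ 0 < t ∧ x s ≠ x t) :
    -- the Riemann–Liouville derivative exists on `(0, ∞)` and is not `T`-periodic
    (ContDiffOn ℝ (FracDeriv.ord α : ℕ) (FracDeriv.kernelIntegral 0 α x) (Set.Ioi 0) ∧
      ¬ FracDeriv.PeriodicOnPos T (FracDeriv.rlDeriv 0 α x)) ∧
    -- the Grünwald–Letnikov derivative exists on `(0, ∞)`, equals the Riemann–Liouville
    -- derivative there, and is not `T`-periodic
    ((∀ t, 0 < t → FracDeriv.HasGLDerivAt 0 α x (FracDeriv.glDeriv 0 α x t) t) ∧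
      (∀ t, 0 < t → FracDeriv.glDeriv 0 α x t = FracDeriv.rlDeriv 0 α x t) ∧
      ¬ FracDeriv.PeriodicOnPos T (FracDeriv.glDeriv 0 α x)) ∧
    -- the limits `c k` of the derivatives of `x` at `0⁺` exist, and they decide between
    -- blow-up at `0⁺` and equality with the Caputo derivative
    (∃ c : ℕ → ℝ,
      (∀ k < FracDeriv.ord α, Tendsto (iteratedDeriv k x) (𝓝[>] 0) (𝓝 (c k))) ∧
      ((∃ k < FracDeriv.ord α, c k ≠ 0) →
        Tendsto (FracDeriv.rlDeriv 0 α x) (𝓝[>] 0) atTop ∨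
        Tendsto (FracDeriv.rlDeriv 0 α x) (𝓝[>] 0) atBot) ∧
      ((∀ k < FracDeriv.ord α, c k = 0) →
        (∀ t, 0 < t → FracDeriv.rlDeriv 0 α x t = FracDeriv.caputoDeriv 0 α x t) ∧
        ¬ FracDeriv.PeriodicOnPos T (FracDeriv.caputoDeriv 0 α x))) := by
  obtain ⟨s, t, hs, ht, hne⟩ := hnc
  exact corollary1_general α hα hαN 0 T hT x hx hper <|
    (hne.ne_or_ne 0).elim (⟨s, hs, ·⟩) (⟨t, ht, ·⟩)
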